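/- Let $X$ be a real Banach space, let $\lambda_1,\lambda_2>0$, and let $Y\subset X$ be a linear subspace that is $\lambda_1$-complemented in its bidual $Y^{**}$. Suppose that there is a convex set $K\subset X$ with $0\in K$ and $\overline{\operatorname{span}}(K)=Y$ such that there is a $\lambda_2$-Lipschitz retraction of $X$ onto $K$, i.e. a map $R:X\to K$ with $R(x)=x$ for all $x\in K$ and $\|R(x)-R(y)\|\le\lambda_2\|x-y\|$ for all $x,y\in X$. Then $Y$ is $\lambda_1\lambda_2$-complemented in $X$. Here a linear subspace $Y$ of a normed space $E$ is called $\lambda$-complemented in $E$ if there is a bounded linear projection of $E$ onto $Y$ of norm at most $\lambda$, and $Y$ is called $\lambda$-complemented in its bidual if its image under the canonical embedding $Y\to Y^{**}$ is a $\lambda$-complemented subspace of $Y^{**}$. -/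

import Mathlib

open scoped NNReal

/-- A linear subspace `Y` of a normed space `E` is `lam`-complemented in `E` if there is a bounded
linear projection of `E` onto `Y` of norm at most `lam`. -/
def IsComplementedWith {E : Type*} [NormedAddCommGroup E] [NormedSpace ℝ E]
    (lam : ℝ≥0) (Y : Submodule ℝ E) : Prop :=
  ∃ P : E →L[ℝ] Y, (∀ y : Y, P y = y) ∧ ‖P‖ ≤ lam

/-- A normed space `Y` is `lam`-complemented in its bidual if its canonical image is a
`lam`-complemented subspace of `Y**`. -/
def IsComplementedInBidual (lam : ℝ≥0) (Y : Type*) [NormedAddCommGroup Y] [NormedSpace ℝ Y] :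
    Prop :=
  IsComplementedWith (E := StrongDual ℝ (StrongDual ℝ Y)) lam
    (LinearMap.range (NormedSpace.inclusionInDoubleDual ℝ Y).toLinearMap)

/-- `R` is a `lam`-Lipschitz retraction of the metric space `M` onto its subset `N`. -/
structure IsLipschitzRetraction {M : Type*} [MetricSpace M] (lam : ℝ≥0) (N : Set M)
    (R : M → M) : Prop where
  lipschitz : LipschitzWith lam R
  mem : ∀ x, R x ∈ N
  eq_self : ∀ x ∈ N, R x = x

open Filter Topology BoundedContinuousFunction NormedSpace

/-! For `c ∈ K` the difference quotients `t⁻¹ • (R (c + t • x) - c)` are `lam2`-Lipschitz in `x`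
uniformly in `t > 0`, take values in `Y`, and equal `x` as soon as `c + t • x ∈ K`. No single `c`
need serve all directions, but convexity gives one for each finite subset of `K`. A weak-star limit
in `Y**` along these points, with `t → 0` for each of them, is a `lam2`-Lipschitz map `X → Y**` that
is the canonical embedding on `span K`, hence on `Y`
(`IsLipschitzRetraction.exists_lipschitzWith_dual`).

Invariant means on the additive groups `Y` and `X` make this map linear without increasing the
constant or changing it on `Y` (`LipschitzWith.exists_linear_extension`). Composing with the
projection of `Y**` onto `Y` multiplies the norms. -/

/-- Bounded families in a dual space have weak-star limits along ultrafilters. -/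
theorem exists_weakStar_limit {ι E : Type*} [NormedAddCommGroup E] [NormedSpace ℝ E]
    (U : Ultrafilter ι) (φ : ι → StrongDual ℝ E) (C : ℝ) (hφ : ∀ i, ‖φ i‖ ≤ C) :
    ∃ ψ : StrongDual ℝ E, ‖ψ‖ ≤ C ∧ ∀ e, Tendsto (fun i => φ i e) U (𝓝 (ψ e)) := by
  have hc := WeakDual.isCompact_closedBall (𝕜 := ℝ) (0 : StrongDual ℝ E) C
  obtain ⟨ψ, hψ, hlim⟩ := hc.ultrafilter_le_nhds (U.map fun i => StrongDual.toWeakDual (φ i))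
    (by
      rw [le_principal_iff, Ultrafilter.coe_map, mem_map]
      exact Eventually.of_forall fun i => by simpa using hφ i)
  refine ⟨WeakDual.toStrongDual ψ, by simpa using hψ, fun e => ?_⟩
  have h : Tendsto (fun i => StrongDual.toWeakDual (φ i)) U (𝓝 ψ) := hlim
  exact ((WeakDual.eval_continuous e).tendsto ψ).comp h

/-! ### Invariant means on abelian groups -/

section Mean

variable {G : Type*} [AddCommGroup G] [TopologicalSpace G] [IsTopologicalAddGroup G]

/-- Translation of a bounded continuous function. -/
def BoundedContinuousFunction.translate {V : Type*} [PseudoMetricSpace V] (g : G) (f : G →ᵇ V) :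
    G →ᵇ V :=
  f.compContinuous ⟨fun x => x + g, by fun_prop⟩

@[simp]
theorem BoundedContinuousFunction.translate_apply {V : Type*} [PseudoMetricSpace V] (g : G)
    (f : G →ᵇ V) (x : G) : f.translate g x = f (x + g) := rfl

/-- A mean on `G` (a normalized functional of norm at most one on the bounded continuous functions)
that is invariant under translation by the elements of `A`. -/
structure IsInvariantMean (A : Set G) (m : StrongDual ℝ (G →ᵇ ℝ)) : Prop where
  norm_le : ‖m‖ ≤ 1
  map_one : m 1 = 1
  map_translate : ∀ g ∈ A, ∀ f : G →ᵇ ℝ, m (f.translate g) = m f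

/-- A weak-star limit of the Cesàro averages of `m` over the translations by `k • g` gains
invariance under `g`; commutativity preserves the invariance under `A`. -/
theorem exists_isInvariantMean_insert {A : Set G} {m : StrongDual ℝ (G →ᵇ ℝ)}
    (hm : IsInvariantMean A m) (g : G) : ∃ m', IsInvariantMean (insert g A) m' := by
  have hbd : ∀ (f : G →ᵇ ℝ) (h : G), |m (f.translate h)| ≤ ‖f‖ := fun f h =>
    (m.le_of_opNorm_le hm.norm_le _).trans <| by
      rw [one_mul]
      exact (norm_le (norm_nonneg f)).2 fun x => f.norm_coe_le_norm _
  let φ : ℕ → StrongDual ℝ (G →ᵇ ℝ) := fun n =>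
    LinearMap.mkContinuous
      { toFun := fun f => ((n : ℝ) + 1)⁻¹ * ∑ k ∈ Finset.range (n + 1), m (f.translate (k • g))
        map_add' := fun f f' => by
          rw [← mul_add, ← Finset.sum_add_distrib]
          exact congrArg _ (Finset.sum_congr rfl fun k _ =>
            m.map_add (f.translate (k • g)) (f'.translate (k • g)))
        map_smul' := fun a f => by
          simp only [RingHom.id_apply, smul_eq_mul]
          rw [mul_left_comm, Finset.mul_sum (a := a)]
          exact congrArg _ (Finset.sum_congr rfl fun (k : ℕ) _ => m.map_smul a (f.translate (k • g))) } 1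
      (fun f => by
        have h0 : (0 : ℝ) < n + 1 := by positivity
        rw [LinearMap.coe_mk, AddHom.coe_mk, Real.norm_eq_abs, abs_mul, abs_inv, abs_of_pos h0,
          inv_mul_le_iff₀ h0, one_mul]
        refine (Finset.abs_sum_le_sum_abs _ _).trans
          ((Finset.sum_le_sum fun k _ => hbd f (k • g)).trans (by simp)))
  have hφ : ∀ n f, φ n f = ((n : ℝ) + 1)⁻¹ *
      ∑ k ∈ Finset.range (n + 1), m (f.translate (k • g)) := fun _ _ => rfl
  obtain ⟨m', hnorm, hlim⟩ := exists_weakStar_limit (Ultrafilter.of atTop) φ 1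
    fun n => LinearMap.mkContinuous_norm_le _ zero_le_one _
  refine ⟨m', hnorm, ?_, ?_⟩
  · refine tendsto_nhds_unique (hlim 1) (tendsto_const_nhds.congr fun n => ?_)
    have h1 : ∀ h : G, (1 : G →ᵇ ℝ).translate h = 1 := fun h => rfl
    have h0 : (n : ℝ) + 1 ≠ 0 := by positivity
    simp [hφ, h1, hm.map_one, h0]
  · rintro h (rfl | hh) f
    -- The sum telescopes to its two end terms, so the difference is at most `2 * ‖f‖ / (n + 1)`.
    · have hdiff : Tendsto (fun n => φ n (f.translate h) - φ n f) ((Ultrafilter.of atTop : Ultrafilter ℕ) : Filter ℕ)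
          (𝓝 0) := by
        have hz : Tendsto (fun n : ℕ => 2 * ‖f‖ * (1 / ((n : ℝ) + 1))) atTop (𝓝 0) := by
          simpa using (tendsto_one_div_add_atTop_nhds_zero_nat (𝕜 := ℝ)).const_mul (2 * ‖f‖)
        refine squeeze_zero_norm (fun n => ?_) (hz.mono_left (Ultrafilter.of_le atTop))
        have h0 : (0 : ℝ) < n + 1 := by positivity
        have ht : ∀ k : ℕ, (f.translate h).translate (k • h) = f.translate ((k + 1) • h) := by
          intro k
          ext x
          simp only [BoundedContinuousFunction.translate_apply, succ_nsmul, add_assoc]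
        rw [hφ, hφ, ← mul_sub, ← Finset.sum_sub_distrib]
        simp only [ht]
        rw [Finset.sum_range_sub (fun k : ℕ => m (f.translate (k • h))), Real.norm_eq_abs, abs_mul,
          abs_inv, abs_of_pos h0, one_div, mul_comm]
        refine mul_le_mul_of_nonneg_right ((abs_sub _ _).trans ?_) (by positivity)
        linarith [hbd f ((n + 1) • h), hbd f (0 • h)]
      exact sub_eq_zero.1 (tendsto_nhds_unique ((hlim _).sub (hlim _)) hdiff)
    · refine tendsto_nhds_unique (hlim _) ((hlim f).congr fun n => ?_)
      rw [hφ, hφ]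
      refine congrArg _ (Finset.sum_congr rfl fun k _ => ?_)
      rw [← hm.map_translate h hh (f.translate (k • g))]
      congr 1
      ext x
      simp only [BoundedContinuousFunction.translate_apply, add_assoc, add_comm]

theorem exists_isInvariantMean_finset (A : Finset G) :
    ∃ m, IsInvariantMean (A : Set G) m := by
  classical
  induction A using Finset.induction_on with
  | empty =>
    refine ⟨BoundedContinuousFunction.evalCLM ℝ (0 : G), ?_, rfl, by simp⟩
    refine ContinuousLinearMap.opNorm_le_bound _ zero_le_one fun f => ?_
    rw [one_mul]
    exact f.norm_coe_le_norm 0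
  | insert g A _ ih =>
    obtain ⟨m, hm⟩ := ih
    rw [Finset.coe_insert]
    exact exists_isInvariantMean_insert hm g

/-- Abelian groups are amenable. -/
theorem exists_isInvariantMean : ∃ m, IsInvariantMean (Set.univ : Set G) m := by
  choose φ hφ using exists_isInvariantMean_finset (G := G)
  obtain ⟨m, hnorm, hlim⟩ := exists_weakStar_limit (Ultrafilter.of atTop) φ 1
    fun A => (hφ A).norm_le
  refine ⟨m, hnorm, ?_, fun g _ f => ?_⟩
  · exact tendsto_nhds_unique (hlim 1) (tendsto_const_nhds.congr fun A => (hφ A).map_one.symm)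
  · refine tendsto_nhds_unique (hlim _) ((hlim f).congr' ?_)
    filter_upwards [Ultrafilter.of_le _ (eventually_ge_atTop {g})] with A hA
    exact ((hφ A).map_translate g (by simpa using hA) f).symm

/-- Functions with values in a dual space can be averaged over an abelian group. -/
theorem exists_dual_valued_invariant_mean (E : Type*) [NormedAddCommGroup E] [NormedSpace ℝ E] :
    ∃ M : (G →ᵇ StrongDual ℝ E) →ₗ[ℝ] StrongDual ℝ E,
      (∀ f, ‖M f‖ ≤ ‖f‖) ∧ (∀ c, M (const G c) = c) ∧ ∀ g f, M (f.translate g) = M f := by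
  obtain ⟨m, hm⟩ := exists_isInvariantMean (G := G)
  let ev : E → (G →ᵇ StrongDual ℝ E) →L[ℝ] (G →ᵇ ℝ) := fun e =>
    (ContinuousLinearMap.apply ℝ ℝ e).compLeftContinuousBounded G
  have hev : ∀ e f, ‖m (ev e f)‖ ≤ ‖f‖ * ‖e‖ := fun e f =>
    (m.le_of_opNorm_le hm.norm_le _).trans <| by
      rw [one_mul]
      exact (norm_le (by positivity)).2 fun x => (f x).le_of_opNorm_le (f.norm_coe_le_norm x) e
  refine ⟨{ toFun := fun f => LinearMap.mkContinuous
              { toFun := fun e => m (ev e f)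
                map_add' := fun e e' => by
                  rw [← m.map_add]
                  exact congrArg m (ext fun x => (f x).map_add e e')
                map_smul' := fun a e => by
                  rw [RingHom.id_apply, ← m.map_smul]
                  exact congrArg m (ext fun x => (f x).map_smul a e) } ‖f‖ fun e => hev e f
            map_add' := fun f f' => ?_
            map_smul' := fun a f => ?_ }, fun f => ?_, fun c => ?_, fun g f => ?_⟩
  · ext e
    exact (congrArg m ((ev e).map_add f f')).trans (m.map_add _ _)
  · ext e
    exact (congrArg m ((ev e).map_smul a f)).trans (m.map_smul _ _)
  · exact LinearMap.mkContinuous_norm_le _ (norm_nonneg f) fun e => hev e f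
  · ext e
    have h : ev e (const G c) = c e • (1 : G →ᵇ ℝ) := by
      ext x
      exact (mul_one (c e)).symm
    change m (ev e (const G c)) = c e
    rw [h, m.map_smul, hm.map_one, smul_eq_mul, mul_one]
  · ext e
    exact hm.map_translate g trivial (ev e f)

end Mean

/-! ### Linearising Lipschitz maps by averaging -/

/-- Averaging a Lipschitz map into a dual space over the translations by a subspace makes it
additive in the directions of that subspace. -/
theorem LipschitzWith.exists_average {X E : Type*} [NormedAddCommGroup X] [NormedSpace ℝ X]
    [NormedAddCommGroup E] [NormedSpace ℝ E] {C : ℝ≥0} {S : X → StrongDual ℝ E}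
    (hS : LipschitzWith C S) (W : Submodule ℝ X) :
    ∃ T : X → StrongDual ℝ E, LipschitzWith C T ∧ (∀ x, ∀ w ∈ W, T (x + w) = T x + T w) ∧
      ∀ x v, (∀ w ∈ W, S (x + w) - S w = v) → T x = v := by
  obtain ⟨M, hMnorm, hMconst, hMinv⟩ := exists_dual_valued_invariant_mean (G := W) E
  -- Subtracting `S w` makes the function bounded, by `C * ‖x‖`, although `S` itself need not be.
  let F : X → (W →ᵇ StrongDual ℝ E) := fun x =>
    ofNormedAddCommGroup (fun w : W => S (x + w) - S w)
      (by have := hS.continuous; fun_prop) (C * ‖x‖)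
      (fun w => by simpa using hS.norm_sub_le (x + w) w)
  have hF : ∀ x w, F x w = S (x + w) - S w := fun _ _ => rfl
  refine ⟨fun x => M (F x), LipschitzWith.of_dist_le_mul fun x y => ?_, fun x w hw => ?_,
    fun x v h => ?_⟩
  · rw [dist_eq_norm, dist_eq_norm, ← map_sub]
    refine (hMnorm _).trans ((norm_le (by positivity)).2 fun w => ?_)
    rw [BoundedContinuousFunction.sub_apply, hF, hF, sub_sub_sub_cancel_right]
    simpa using hS.norm_sub_le (x + w) (y + w)
  · have h : F (x + w) = (F x).translate ⟨w, hw⟩ + F w := by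
      ext1 z
      rw [BoundedContinuousFunction.add_apply, BoundedContinuousFunction.translate_apply, hF, hF, hF, Submodule.coe_add, add_comm (z : X) w,
        add_assoc, sub_add_sub_cancel]
    simp only [h, map_add, hMinv]
  · rw [← hMconst v]
    exact congrArg M (ext fun w => h w w.2)

/-- A Lipschitz map into a dual space that is linear along a linear map `j` can be replaced by a
bounded linear one. -/
theorem LipschitzWith.exists_linear_extension {X E F : Type*} [NormedAddCommGroup X]
    [NormedSpace ℝ X] [NormedAddCommGroup E] [NormedSpace ℝ E] [AddCommGroup F] [Module ℝ F]
    {C : ℝ≥0} {S : X → StrongDual ℝ E} (hS : LipschitzWith C S) (j : F →ₗ[ℝ] X)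
    (J : F →ₗ[ℝ] StrongDual ℝ E) (hJ : ∀ y, S (j y) = J y) :
    ∃ T : X →L[ℝ] StrongDual ℝ E, ‖T‖ ≤ C ∧ ∀ y, T (j y) = J y := by
  -- Averaging over all of `X` preserves the values on the range of `j` only if the increments along
  -- that range are constant everywhere on `X`; this first average ensures it.
  obtain ⟨S', hS', hadd, hval⟩ := hS.exists_average (LinearMap.range j)
  have hS'J : ∀ y, S' (j y) = J y := fun y => hval (j y) (J y) <| by
    rintro _ ⟨w, rfl⟩
    rw [← map_add, hJ, hJ, map_add, add_sub_cancel_right]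
  obtain ⟨T, hT, hTadd, hTval⟩ := hS'.exists_average ⊤
  let L : X →L[ℝ] StrongDual ℝ E :=
    (AddMonoidHom.mk' T fun x y => hTadd x y trivial).toRealLinearMap hT.continuous
  have hL : ∀ x, L x = T x := fun _ => rfl
  refine ⟨L, L.opNorm_le_bound C.2 fun x => ?_, fun y => ?_⟩
  · have h := hT.norm_sub_le x 0
    rwa [← hL, ← hL, map_zero, sub_zero, sub_zero] at h
  · refine hTval (j y) (J y) fun w _ => ?_
    rw [add_comm, hadd w (j y) ⟨y, rfl⟩, hS'J, add_sub_cancel_left]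

/-! ### Differentiating the retraction along the convex set -/

/-- In a convex set containing `0`, each finite subset admits a point from which one can move in
both directions of each of its elements. -/
theorem Convex.exists_forall_add_smul_mem {X : Type*} [AddCommGroup X] [Module ℝ X] {K : Set X}
    (hK : Convex ℝ K) (h0 : (0 : X) ∈ K) (s : Finset K) :
    ∃ c ∈ K, ∀ k ∈ s, ∃ δ > 0, ∀ r : ℝ, |r| ≤ δ → c + r • (k : X) ∈ K := by
  classical
  have h3 : ∀ a ∈ K, ∀ b ∈ K, ∀ p q : ℝ, 0 ≤ p → 0 ≤ q → p + q ≤ 1 → p • a + q • b ∈ K := by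
    intro a ha b hb p q hp hq hpq
    have h := hK.sum_mem (t := Finset.univ) (w := ![p, q, 1 - p - q]) (z := ![a, b, 0])
      (by intro i _; fin_cases i <;> simp <;> linarith)
      (by simp [Fin.sum_univ_three])
      (by intro i _; fin_cases i <;> simp [ha, hb, h0])
    simpa [Fin.sum_univ_three] using h
  induction s using Finset.induction_on with
  | empty => exact ⟨0, h0, by simp⟩
  | insert k s _ ih =>
    obtain ⟨c, hc, hs⟩ := ih
    -- The remaining weight `1 / 3` rests on `0`, so the coefficient of `k` can vary by `1 / 3`
    -- either way; older directions keep their room, scaled by `1 / 3`.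
    refine ⟨(1 / 3 : ℝ) • c + (1 / 3 : ℝ) • (k : X),
      h3 c hc k k.2 _ _ (by norm_num) (by norm_num) (by norm_num), fun j hj => ?_⟩
    rcases Finset.mem_insert.1 hj with rfl | hj
    · refine ⟨1 / 3, by norm_num, fun r hr => ?_⟩
      rw [abs_le] at hr
      have h := h3 c hc j j.2 (1 / 3) (1 / 3 + r) (by norm_num) (by linarith) (by linarith)
      rwa [add_smul, ← add_assoc] at h
    · obtain ⟨δ, hδ, h⟩ := hs j hj
      refine ⟨δ / 3, by positivity, fun r hr => ?_⟩
      have h' := h3 _ (h (3 * r) (by rw [abs_mul, abs_of_pos (by norm_num : (0 : ℝ) < 3)]; linarith))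
        k k.2 (1 / 3) (1 / 3) (by norm_num) (by norm_num) (by norm_num)
      convert h' using 1
      module

/-- A convex set containing `0` has a net of points and scales at which every direction of its
span is eventually admissible. -/
theorem Convex.exists_eventually_add_smul_mem {X : Type*} [AddCommGroup X] [Module ℝ X]
    {K : Set X} (hK : Convex ℝ K) (h0 : (0 : X) ∈ K) :
    ∃ (c : Finset K → K), ∀ w ∈ Submodule.span ℝ K,
      ∀ᶠ i : Finset K × ℝ in atTop.curry (𝓝[>] 0), (c i.1 : X) + i.2 • w ∈ K := by
  choose c hc hcK using hK.exists_forall_add_smul_mem h0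
  refine ⟨fun s => ⟨c s, hc s⟩, fun w hw => ?_⟩
  have hscale : ∀ a : ℝ, 0 < a → Tendsto (fun t : ℝ => a * t) (𝓝[>] 0) (𝓝[>] 0) := by
    intro a ha
    refine tendsto_nhdsWithin_iff.2 ⟨?_, ?_⟩
    · exact Tendsto.mono_left (by simpa using (continuous_const_mul a).tendsto 0)
        nhdsWithin_le_nhds
    · filter_upwards [self_mem_nhdsWithin] with t ht
      exact mul_pos ha ht
  -- All multiples of `w` are treated at once so that the induction passes through scalar multiples,
  -- including negative ones.
  suffices h : ∀ a : ℝ, ∀ᶠ s in atTop, ∀ᶠ t in 𝓝[>] (0 : ℝ), c s + t • a • w ∈ K by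
    rw [eventually_curry_iff]
    simpa using h 1
  induction hw using Submodule.span_induction with
  | mem k hk =>
    intro a
    filter_upwards [eventually_ge_atTop {⟨k, hk⟩}] with s hs
    obtain ⟨δ, hδ, h⟩ := hcK s ⟨k, hk⟩ (by simpa using hs)
    have ht : Tendsto (fun t : ℝ => |t * a|) (𝓝[>] 0) (𝓝 0) :=
      Tendsto.mono_left (by simpa using ((continuous_mul_const a).abs.tendsto 0))
        nhdsWithin_le_nhds
    filter_upwards [ht.eventually (ge_mem_nhds hδ)] with t ht
    rw [smul_smul]
    exact h _ ht
  | zero => exact fun a => by simp [hc]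
  | add x y _ _ hx hy =>
    intro a
    filter_upwards [hx a, hy a] with s hxs hys
    -- The point for `x + y` at scale `t` is the midpoint of those for `x` and `y` at scale `2 * t`.
    filter_upwards [(hscale 2 two_pos).eventually hxs, (hscale 2 two_pos).eventually hys]
      with t hxt hyt
    have h := hK hxt hyt (a := 1 / 2) (b := 1 / 2) (by norm_num) (by norm_num) (by norm_num)
    convert h using 1
    module
  | smul b x _ hx =>
    intro a
    simpa only [smul_smul] using hx (a * b)

/-- A Lipschitz retraction onto a convex set `K` yields, by differentiation along `K`, a Lipschitz
map into a dual space that extends a given isometric embedding of the closed span of `K`. -/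
theorem IsLipschitzRetraction.exists_lipschitzWith_dual {X E F : Type*} [NormedAddCommGroup X]
    [NormedSpace ℝ X] [NormedAddCommGroup E] [NormedSpace ℝ E] [NormedAddCommGroup F]
    [NormedSpace ℝ F] {C : ℝ≥0} {K : Set X} {R : X → X}
    (hR : IsLipschitzRetraction C K R) (hK : Convex ℝ K) (h0 : (0 : X) ∈ K) (j : E →ₗᵢ[ℝ] X)
    (hj : (Submodule.span ℝ K).topologicalClosure = LinearMap.range j.toLinearMap)
    (J : E →ₗᵢ[ℝ] StrongDual ℝ F) :
    ∃ S : X → StrongDual ℝ F, LipschitzWith C S ∧ ∀ y : E, S (j y) = J y := by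
  have hspanj : ∀ w ∈ Submodule.span ℝ K, ∃ y, j y = w := fun w hw => by
    have h := (Submodule.span ℝ K).le_topologicalClosure hw
    rwa [hj] at h
  obtain ⟨c, hc⟩ := hK.exists_eventually_add_smul_mem h0
  have hF : (atTop.curry (𝓝[>] 0) : Filter (Finset K × ℝ)).NeBot := by
    rw [neBot_iff, ne_eq, ← empty_mem_iff_bot, mem_curry_iff]
    simpa using fun s => ⟨⟨s, subset_rfl⟩, NeBot.ne inferInstance⟩
  set L : Filter (Finset K × ℝ) := atTop.curry (𝓝[>] 0)
  choose q hq using fun k : K => hspanj k (Submodule.subset_span k.2)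
  -- Difference quotients of `R` at `c i.1`, pulled back to `E` through `j`. At `i.2 = 0` they
  -- vanish since `0⁻¹ = 0`, so the Lipschitz bound holds for every index.
  let D : Finset K × ℝ → X → E := fun i x =>
    i.2⁻¹ • (q ⟨R (c i.1 + i.2 • x), hR.mem _⟩ - q (c i.1))
  have hjD : ∀ i x, j (D i x) = i.2⁻¹ • (R (c i.1 + i.2 • x) - c i.1) := fun i x => by
    simp only [D, map_smul, map_sub, hq]
  have hDlip : ∀ i x x', ‖D i x - D i x'‖ ≤ C * ‖x - x'‖ := by
    intro i x x'
    rw [← j.norm_map, map_sub, hjD, hjD, ← smul_sub, sub_sub_sub_cancel_right, norm_smul, norm_inv]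
    have h := hR.lipschitz.norm_sub_le (c i.1 + i.2 • x) (c i.1 + i.2 • x')
    rw [add_sub_add_left_eq_sub, ← smul_sub, norm_smul] at h
    rcases eq_or_ne i.2 0 with hi | hi
    · rw [hi, norm_zero, inv_zero, zero_mul]
      positivity
    · rw [inv_mul_le_iff₀ (norm_pos_iff.2 hi), mul_left_comm]
      exact h
  have hDzero : ∀ i, D i 0 = 0 := fun i => j.injective <| by
    rw [hjD, smul_zero, add_zero, hR.eq_self _ (c i.1).2, sub_self, smul_zero, map_zero]
  have hDspan : ∀ y : E, j y ∈ Submodule.span ℝ K → ∀ᶠ i in L, D i (j y) = y := by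
    intro y hy
    have hpos : ∀ᶠ i in L, 0 < i.2 :=
      eventually_curry_iff.2 (Eventually.of_forall fun _ => self_mem_nhdsWithin)
    filter_upwards [hc _ hy, hpos] with i hi hi0
    apply j.injective
    rw [hjD, hR.eq_self _ hi, add_sub_cancel_left, inv_smul_smul₀ hi0.ne']
  choose S _ hS using fun x => exists_weakStar_limit (Ultrafilter.of L)
    (fun i => J (D i x)) (C * ‖x‖) fun i => by
      rw [J.norm_map]
      simpa [hDzero] using hDlip i x 0
  have hSlip : LipschitzWith C S := LipschitzWith.of_dist_le_mul fun x x' => by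
    rw [dist_eq_norm, dist_eq_norm]
    refine ContinuousLinearMap.opNorm_le_bound _ (by positivity) fun f => ?_
    refine le_of_tendsto ((hS x f).sub (hS x' f)).norm (Eventually.of_forall fun i => ?_)
    rw [← _root_.sub_apply, ← map_sub]
    exact ContinuousLinearMap.le_of_opNorm_le _ ((J.norm_map _).trans_le (hDlip i x x')) f
  refine ⟨S, hSlip, fun y => ?_⟩
  have hspan : ∀ w : E, j w ∈ Submodule.span ℝ K → S (j w) = J w := by
    intro w hw
    ext f
    refine tendsto_nhds_unique (hS (j w) f) (tendsto_const_nhds.congr' ?_)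
    filter_upwards [Ultrafilter.of_le L (hDspan w hw)] with i hi
    rw [hi]
  -- Both sides are continuous, so agreement on the dense preimage of `span K` extends to all of
  -- `E`.
  have hclosed : IsClosed {w : E | S (j w) = J w} :=
    isClosed_eq (hSlip.continuous.comp j.continuous) J.continuous
  have hdense : y ∈ closure (j ⁻¹' (Submodule.span ℝ K : Set X)) := by
    have himage : j '' (j ⁻¹' (Submodule.span ℝ K : Set X)) = Submodule.span ℝ K :=
      Set.image_preimage_eq_of_subset fun w hw => hspanj w hw
    rw [j.isometry.isUniformInducing.isInducing.closure_eq_preimage_closure_image, himage,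
      ← Submodule.topologicalClosure_coe, hj]
    exact ⟨y, rfl⟩
  exact closure_minimal hspan hclosed hdense

/-- A projection onto the range of a linear isometry gives a left inverse of that isometry. -/
theorem IsComplementedWith.exists_linear_retraction {V E : Type*} [NormedAddCommGroup V]
    [NormedSpace ℝ V] [NormedAddCommGroup E] [NormedSpace ℝ E] {lam : ℝ≥0} (i : E →ₗᵢ[ℝ] V)
    (h : IsComplementedWith lam (LinearMap.range i.toLinearMap)) :
    ∃ Q : V →L[ℝ] E, (∀ y, Q (i y) = y) ∧ ‖Q‖ ≤ lam := by
  obtain ⟨P, hP, hPnorm⟩ := h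
  refine ⟨(i.equivRange.symm.toContinuousLinearEquiv : _ →L[ℝ] E).comp P, fun y => ?_,
    ContinuousLinearMap.opNorm_le_bound _ lam.coe_nonneg fun x => ?_⟩
  · change i.equivRange.symm (P (i.equivRange y)) = y
    rw [hP, LinearIsometryEquiv.symm_apply_apply]
  · change ‖i.equivRange.symm (P x)‖ ≤ _
    rw [LinearIsometryEquiv.norm_map]
    exact P.le_of_opNorm_le hPnorm x

/-- If `K` is a convex Lipschitz retract of `X` containing `0`, whose closed span is isometric to a
space `E` complemented in some dual space, then `E` is complemented in `X`. -/
theorem IsLipschitzRetraction.exists_linear_retraction {X E F : Type*} [NormedAddCommGroup X]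
    [NormedSpace ℝ X] [NormedAddCommGroup E] [NormedSpace ℝ E] [NormedAddCommGroup F]
    [NormedSpace ℝ F] {lam1 lam2 : ℝ≥0} {K : Set X} {R : X → X}
    (hR : IsLipschitzRetraction lam2 K R) (hK : Convex ℝ K) (h0 : (0 : X) ∈ K) (j : E →ₗᵢ[ℝ] X)
    (hj : (Submodule.span ℝ K).topologicalClosure = LinearMap.range j.toLinearMap)
    (J : E →ₗᵢ[ℝ] StrongDual ℝ F)
    (hJ : IsComplementedWith lam1 (LinearMap.range J.toLinearMap)) :
    ∃ Q : X →L[ℝ] E, (∀ y, Q (j y) = y) ∧ ‖Q‖ ≤ (lam1 * lam2 : ℝ≥0) := by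
  obtain ⟨S, hS, hSJ⟩ := hR.exists_lipschitzWith_dual hK h0 j hj J
  obtain ⟨T, hT, hTJ⟩ := hS.exists_linear_extension j.toLinearMap J.toLinearMap hSJ
  obtain ⟨P, hP, hPnorm⟩ := IsComplementedWith.exists_linear_retraction J hJ
  refine ⟨P.comp T, fun y => ?_, (P.opNorm_comp_le T).trans ?_⟩
  · exact (congrArg P (hTJ y)).trans (hP y)
  · rw [NNReal.coe_mul]
    exact mul_le_mul hPnorm hT (norm_nonneg T) lam1.coe_nonneg

theorem mainTheorem6 {X : Type*} [NormedAddCommGroup X] [NormedSpace ℝ X] [CompleteSpace X]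
    (lam1 lam2 : ℝ≥0) (hlam1 : 0 < lam1) (hlam2 : 0 < lam2)
    (Y : Submodule ℝ X) (hY : IsComplementedInBidual lam1 Y)
    (K : Set X) (hKconvex : Convex ℝ K) (hK0 : (0 : X) ∈ K)
    (hKspan : (Submodule.span ℝ K).topologicalClosure = Y)
    (hretr : ∃ R : X → X, IsLipschitzRetraction lam2 K R) :
    IsComplementedWith (lam1 * lam2) Y := by
  obtain ⟨R, hR⟩ := hretr
  exact hR.exists_linear_retraction hKconvex hK0 Y.subtypeₗᵢ
    (hKspan.trans Y.range_subtype.symm) (inclusionInDoubleDualLi ℝ) hY
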